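/- A tracial $C^*$-probability space $(M,\tau)$ is a unital $C^*$-algebra $M$ with a trace state $\tau$ (a positive linear functional with $\tau(1)=1$ and $\tau(ab)=\tau(ba)$; it need not be faithful); put $|a|_2=\tau(a^*a)^{1/2}$. Two $n$-tuples in tracial $C^*$-probability spaces have the same $*$-distribution if all their $*$-moments (the values of the traces on words in the variables and their adjoints) agree. For $n$-tuples $(X_1,\dots,X_n)$ in $(M_1,\tau_1)$ and $(Y_1,\dots,Y_n)$ in $(M_2,\tau_2)$, the free Wasserstein distance is $$W\big((X_1,\dots,X_n),(Y_1,\dots,Y_n)\big)=\inf\Big(\sum_{j=1}^n|X_j'-Y_j'|_2^2\Big)^{1/2},$$ where the infimum is over all $2n$-tuples $(X_1',\dots,X_n',Y_1',\dots,Y_n')$ in some tracial $C^*$-probability space $(M_3,\tau_3)$ such that $(X_1',\dots,X_n')$ has the same $*$-distribution as $(X_1,\dots,X_n)$ and $(Y_1',\dots,Y_n')$ has the same $*$-distribution as $(Y_1,\dots,Y_n)$. For probability measures $\mu,\nu$ on $\mathbb R^n$, the classical Wasserstein distance is $$W(\mu,\nu)=\inf_{\pi\in\Pi(\mu,\nu)}\Big(\int|x-y|^2\,d\pi(x,y)\Big)^{1/2},$$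 where $|\cdot|$ is the Euclidean norm and $\Pi(\mu,\nu)$ is the set of probability measures on $\mathbb R^n\times\mathbb R^n$ with marginals $\mu$ and $\nu$. If $X_1,\dots,X_n$ are commuting self-adjoint elements of $(M,\tau)$, their joint distribution $\mu_{X_1,\dots,X_n}$ is the unique compactly supported probability measure on $\mathbb R^n$ with $\tau(X_{i_1}\cdots X_{i_k})=\int x_{i_1}\cdots x_{i_k}\,d\mu_{X_1,\dots,X_n}(x)$ for all $k\ge 0$ and all $i_1,\dots,i_k\in\{1,\dots,n\}$. **Theorem 1.5.** Let $(X_1,\dots,X_n)$ and $(Y_1,\dots,Y_n)$ be two $n$-tuples of commuting self-adjoint variables in tracial $C^*$-probability spaces $(M_1,\tau_1)$ and $(M_2,\tau_2)$ (the $X_j$ commute with each other, and so do the $Y_j$). Then the free and classical Wasserstein distances are equal: $$W\big((X_1,\dots,X_n),(Y_1,\dots,Y_n)\big)=W\big(\mu_{X_1,\dots,X_n},\mu_{Y_1,\dots,Y_n}\big).$$ -/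

import Mathlib

open MeasureTheory
open scoped ENNReal ComplexOrder

namespace FreeProb

/-- A trace state on the unital C*-algebra `M`: a positive, unital, tracial linear functional.
(The positive elements of a C*-algebra are exactly the elements `a* a`.) The pair `(M, τ)` is a
tracial C*-probability space; the trace is not required to be faithful. -/
structure TraceState (M : Type*) [CStarAlgebra M] where
  toLinearMap : M →ₗ[ℂ] ℂ
  map_one' : toLinearMap 1 = 1
  nonneg' : ∀ a : M, 0 ≤ toLinearMap (star a * a)
  tracial' : ∀ a b : M, toLinearMap (a * b) = toLinearMap (b * a)

noncomputable instance {M : Type*} [CStarAlgebra M] : CoeFun (TraceState M) (fun _ => M → ℂ) :=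
  ⟨fun τ => τ.toLinearMap⟩

/-- The `2`-norm `|a|_2 = τ(a* a) ^ (1/2)` of a tracial C*-probability space. -/
noncomputable def norm2 {M : Type*} [CStarAlgebra M] (τ : TraceState M) (a : M) : ℝ :=
  Real.sqrt (τ (star a * a)).re

/-- The `*`-moment of the tuple `a` along the word `w`, in which the letter `Sum.inl j` stands for
`a j` and the letter `Sum.inr j` for `(a j)*`. -/
noncomputable def starMoment {M : Type*} [CStarAlgebra M] (τ : TraceState M) {n : ℕ}
    (a : Fin n → M) (w : List (Fin n ⊕ Fin n)) : ℂ :=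
  τ (w.map (Sum.elim a (fun j => star (a j)))).prod

/-- Two tuples of noncommutative random variables have the same `*`-distribution: all their
`*`-moments (hence their expectations of all noncommutative `*`-polynomials) agree. -/
def SameStarDistribution {M N : Type*} [CStarAlgebra M] [CStarAlgebra N]
    (τ : TraceState M) (σ : TraceState N) {n : ℕ} (a : Fin n → M) (b : Fin n → N) : Prop :=
  ∀ w : List (Fin n ⊕ Fin n), starMoment τ a w = starMoment σ b w

/-- The free Wasserstein distance `W = W_2` of two tuples of noncommutative random variables:
the infimum of `(∑ j, |X'_j - Y'_j|_2 ^ 2) ^ (1/2)` over all `2n`-tuples `(X', Y')` in some tracial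
C*-probability space such that `X'` has the `*`-distribution of `X` and `Y'` that of `Y`.
Here the algebras carrying the `2n`-tuple range over an arbitrary universe `w`, independent of
those of the given algebras. -/
noncomputable def freeWasserstein.{u, v, w} {M₁ : Type u} {M₂ : Type v}
    [CStarAlgebra M₁] [CStarAlgebra M₂] (τ₁ : TraceState M₁) (τ₂ : TraceState M₂) {n : ℕ}
    (X : Fin n → M₁) (Y : Fin n → M₂) : ℝ≥0∞ :=
  ⨅ (M₃ : Type w) (_ : CStarAlgebra M₃) (τ₃ : TraceState M₃) (X' : Fin n → M₃) (Y' : Fin n → M₃)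
    (_ : SameStarDistribution τ₃ τ₁ X' X) (_ : SameStarDistribution τ₃ τ₂ Y' Y),
    ENNReal.ofReal (Real.sqrt (∑ j, norm2 τ₃ (X' j - Y' j) ^ 2))

/-- The classical Wasserstein distance on `ℝ^n`, with the Euclidean norm: the infimum of
`(∫ |x - y| ^ 2 dπ(x, y)) ^ (1/2)` over the probability measures `π` on `ℝ^n × ℝ^n` with
marginals `μ` and `ν`. -/
noncomputable def classicalWasserstein {n : ℕ} (μ ν : Measure (EuclideanSpace ℝ (Fin n))) : ℝ≥0∞ :=
  ⨅ (π : Measure (EuclideanSpace ℝ (Fin n) × EuclideanSpace ℝ (Fin n)))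
    (_ : IsProbabilityMeasure π) (_ : π.fst = μ) (_ : π.snd = ν),
    (∫⁻ z, ‖z.1 - z.2‖ₑ ^ 2 ∂π) ^ (1 / 2 : ℝ)

/-- `μ` is the joint distribution of the tuple `X` of commuting self-adjoint variables: the
compactly supported probability measure on `ℝ^n` whose moments are those of `X`. (A compactly
supported measure is determined by its moments, so there is at most one.) -/
structure IsJointDistribution {M : Type*} [CStarAlgebra M] (τ : TraceState M) {n : ℕ}
    (X : Fin n → M) (μ : Measure (EuclideanSpace ℝ (Fin n))) : Prop where
  isProbabilityMeasure : IsProbabilityMeasure μ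
  compactSupport : ∃ K : Set (EuclideanSpace ℝ (Fin n)), IsCompact K ∧ μ Kᶜ = 0
  moments : ∀ w : List (Fin n),
    τ (w.map X).prod = ((∫ x, (w.map (fun j => x j)).prod ∂μ : ℝ) : ℂ)

/-- Existence of the joint distribution in a commutative C*-algebra. -/
theorem exists_isJointDistribution_of_comm {A : Type*} [CommCStarAlgebra A] (τ : TraceState A)
    {n : ℕ} (X : Fin n → A) (hX : ∀ j, IsSelfAdjoint (X j)) :
    ∃ μ : Measure (EuclideanSpace ℝ (Fin n)), IsJointDistribution τ X μ := by
  let _ : MeasurableSpace (WeakDual.characterSpace ℂ A) := borel _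
  have : BorelSpace (WeakDual.characterSpace ℂ A) := ⟨rfl⟩
  let G := gelfandStarTransform A
  let c : C(WeakDual.characterSpace ℂ A, ℝ) → C(WeakDual.characterSpace ℂ A, ℂ) :=
    fun f => ⟨fun x => (f x : ℂ), by fun_prop⟩
  let L₀ : CompactlySupportedContinuousMap (WeakDual.characterSpace ℂ A) ℝ →ₗ[ℝ] ℝ :=
    { toFun := fun f => (τ (G.symm (c f))).re
      map_add' := by
        intro f g
        have : c ((f + g : CompactlySupportedContinuousMap (WeakDual.characterSpace ℂ A) ℝ) :
            C(WeakDual.characterSpace ℂ A, ℝ)) = c f + c g := by ext x; simp [c]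
        rw [this]; simp
      map_smul' := by
        intro r f
        have : c ((r • f : CompactlySupportedContinuousMap (WeakDual.characterSpace ℂ A) ℝ) :
            C(WeakDual.characterSpace ℂ A, ℝ)) = (r : ℂ) • c f := by ext x; simp [c]
        rw [this]; simp }
  have hpos : ∀ f, 0 ≤ f → 0 ≤ L₀ f := by
    intro f hf
    let g : C(WeakDual.characterSpace ℂ A, ℂ) :=
      ⟨fun x => ((Real.sqrt (f x) : ℝ) : ℂ), by fun_prop⟩
    have hg : c f = star g * g := by
      ext x
      have h0 : 0 ≤ f x := hf x
      simp only [c, g, ContinuousMap.coe_mk, ContinuousMap.mul_apply, ContinuousMap.star_apply]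
      rw [show star ((Real.sqrt (f x) : ℝ) : ℂ) = ((Real.sqrt (f x) : ℝ) : ℂ) from
        Complex.conj_ofReal _, ← Complex.ofReal_mul, Real.mul_self_sqrt h0]
    change 0 ≤ (τ (G.symm (c f))).re
    rw [hg, map_mul, map_star]
    exact (Complex.le_def.1 (τ.nonneg' (G.symm g))).1
  let L := PositiveLinearMap.mk₀ L₀ hpos
  let ρ := RealRMK.rieszMeasure L
  have hρ : ∀ f : C(WeakDual.characterSpace ℂ A, ℝ), ∫ x, f x ∂ρ = (τ (G.symm (c f))).re :=
    fun f => RealRMK.integral_rieszMeasure L (CompactlySupportedContinuousMap.continuousMapEquiv f)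
  have : IsFiniteMeasure ρ := inferInstance
  have hρ1 : ρ.real Set.univ = 1 := by
    have h := hρ 1
    have h1 : c 1 = 1 := by ext x; simp [c]
    rw [h1, map_one, τ.map_one'] at h
    simpa using h
  have : IsProbabilityMeasure ρ := ⟨by
    rw [← ENNReal.toReal_eq_one_iff]; exact hρ1⟩
  let Φ : WeakDual.characterSpace ℂ A → EuclideanSpace ℝ (Fin n) :=
    fun φ => WithLp.toLp 2 (fun j => (G (X j) φ).re)
  have hΦ : Continuous Φ := by
    refine (PiLp.continuous_toLp 2 _).comp (continuous_pi fun j => ?_)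
    exact Complex.continuous_re.comp (G (X j)).continuous
  have hreal : ∀ j φ, (((G (X j) φ).re : ℝ) : ℂ) = G (X j) φ := by
    intro j φ
    have : star (G (X j)) = G (X j) := by rw [← map_star, (hX j).star_eq]
    exact Complex.conj_eq_iff_re.1 (congrArg (fun f => f φ) this)
  refine ⟨ρ.map Φ, Measure.isProbabilityMeasure_map hΦ.measurable.aemeasurable,
    ⟨Set.range Φ, isCompact_range hΦ, ?_⟩, ?_⟩
  · rw [Measure.map_apply hΦ.measurable (isCompact_range hΦ).isClosed.measurableSet.compl]
    convert measure_empty (μ := ρ)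
    ext x; simp
  · intro w
    have hcont : Continuous fun x : EuclideanSpace ℝ (Fin n) =>
        (w.map (fun j => x j)).prod := by
      refine continuous_list_prod w fun j _ => ?_
      fun_prop
    rw [integral_map hΦ.measurable.aemeasurable hcont.aestronglyMeasurable]
    let f : C(WeakDual.characterSpace ℂ A, ℝ) := ⟨_, hcont.comp hΦ⟩
    have hf : c f = G (w.map X).prod := by
      ext φ
      change (((w.map (fun j => (G (X j) φ).re)).prod : ℝ) : ℂ) = _
      clear f hcont
      induction w with
      | nil => simp
      | cons a w ih => simp [hreal, ih]
    have h := hρ f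
    have him : (τ (w.map X).prod).im = 0 := by
      have hs : IsSelfAdjoint (w.map X).prod := by
        clear h hf f hcont
        induction w with
        | nil => simp
        | cons a w ih => simpa using (hX a).mul ih
      have key : (4 : ℂ) * τ (w.map X).prod =
          τ (star ((w.map X).prod + 1) * ((w.map X).prod + 1)) -
          τ (star ((w.map X).prod - 1) * ((w.map X).prod - 1)) := by
        rw [star_add, star_sub, hs.star_eq, star_one, ← map_sub]
        rw [show ((w.map X).prod + 1) * ((w.map X).prod + 1) -
          ((w.map X).prod - 1) * ((w.map X).prod - 1) = (4 : ℂ) • (w.map X).prod by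
            rw [Algebra.smul_def, map_ofNat]; ring]
        simp
      have h1 := (Complex.le_def.1 (τ.nonneg' ((w.map X).prod + 1))).2
      have h2 := (Complex.le_def.1 (τ.nonneg' ((w.map X).prod - 1))).2
      have h3 := congrArg Complex.im key
      simp only [Complex.sub_im, ← h1, ← h2, Complex.mul_im] at h3
      simpa using h3
    rw [hf, StarAlgEquiv.symm_apply_apply] at h
    change _ = ((∫ x, f x ∂ρ : ℝ) : ℂ)
    rw [h]
    exact Complex.ext rfl (by simpa using him)

/-- Commuting self-adjoint variables in a tracial C*-probability space have a joint
distribution. -/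
theorem exists_isJointDistribution {M : Type*} [CStarAlgebra M] (τ : TraceState M)
    {n : ℕ} (X : Fin n → M) (hX : ∀ j, IsSelfAdjoint (X j)) (hXc : ∀ i j, Commute (X i) (X j)) :
    ∃ μ : Measure (EuclideanSpace ℝ (Fin n)), IsJointDistribution τ X μ := by
  let S₀ := StarAlgebra.adjoin ℂ (Set.range X)
  have hS₀ : ∀ a b : S₀, a * b = b * a := by
    have := StarAlgebra.isMulCommutative_adjoin ℂ (s := Set.range X)
      (by rintro _ ⟨i, rfl⟩ _ ⟨j, rfl⟩; exact hXc i j)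
      (by rintro _ ⟨i, rfl⟩ _ ⟨j, rfl⟩; rw [(hX j).star_eq]; exact hXc i j)
    exact fun a b => this.is_comm.comm a b
  let S := S₀.topologicalClosure
  have hS : ∀ a b : S, a * b = b * a := by
    let _ := StarSubalgebra.commRingTopologicalClosure S₀ hS₀
    exact fun a b => mul_comm a b
  have : IsClosed (S : Set M) := StarSubalgebra.isClosed_topologicalClosure S₀
  let _ : CommCStarAlgebra S := { (inferInstance : CStarAlgebra S) with mul_comm := hS }
  let τS : TraceState S :=
    { toLinearMap := τ.toLinearMap ∘ₗ S.subtype.toAlgHom.toLinearMap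
      map_one' := τ.map_one'
      nonneg' := fun a => τ.nonneg' (a : M)
      tracial' := fun a b => τ.tracial' (a : M) (b : M) }
  let XS : Fin n → S := fun j =>
    ⟨X j, StarSubalgebra.le_topologicalClosure _ (StarAlgebra.subset_adjoin ℂ _ ⟨j, rfl⟩)⟩
  obtain ⟨μ, h1, h2, h3⟩ := exists_isJointDistribution_of_comm τS XS
    (fun j => Subtype.ext (hX j))
  refine ⟨μ, h1, h2, fun w => ?_⟩
  rw [← h3 w]
  change _ = τ ((w.map XS).prod : S)
  congr 1
  induction w with
  | nil => rfl
  | cons a w ih => simp only [List.map_cons, List.prod_cons, ih]; rfl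

/-- The joint distribution `μ_{X_1, …, X_n}` on `ℝ^n` of commuting self-adjoint variables. -/
noncomputable def jointDistribution {M : Type*} [CStarAlgebra M] (τ : TraceState M)
    {n : ℕ} (X : Fin n → M) (hX : ∀ j, IsSelfAdjoint (X j)) (hXc : ∀ i j, Commute (X i) (X j)) :
    Measure (EuclideanSpace ℝ (Fin n)) :=
  (exists_isJointDistribution τ X hX hXc).choose

theorem isJointDistribution_jointDistribution {M : Type*} [CStarAlgebra M] (τ : TraceState M)
    {n : ℕ} (X : Fin n → M) (hX : ∀ j, IsSelfAdjoint (X j)) (hXc : ∀ i j, Commute (X i) (X j)) :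
    IsJointDistribution τ X (jointDistribution τ X hX hXc) :=
  (exists_isJointDistribution τ X hX hXc).choose_spec

end FreeProb

universe u v w

namespace FreeProb

/-! Free couplings contain the classical ones: a coupling `π` of compactly supported laws lives on a
compact set, where the coordinate functions in the continuous functions, traced by integration, form
an admissible `2n`-tuple of the same cost. Hence free ≤ classical.

For the converse the two tuples `x`, `y` of a free coupling need not commute with each other, so
they have no joint law directly. On the GNS space of the trace, however, left multiplication by the
`x j` commutes with right multiplication by the `y j`. Traciality makes right multiplication a
bounded `*`-representation of the opposite algebra. The resulting `2n` commuting self-adjoint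
operators have a joint spectral measure `π` in the vacuum state, with `∫ v(s) w(t) dπ(s, t) = τ(v(x)
w(y))` for all words `v`, `w` (`exists_bimodule_law`). Moments of this shape determine both
marginals, by `IsJointDistribution.unique`, and also the cost, whose only mixed term is `τ(x j * y
j)`. Hence classical ≤ free.

As the trace need not be faithful, `x` and `y` are self-adjoint and commuting only modulo its null
ideal; the GNS representations kill that ideal. -/

/-! ### Compactly supported measures: moments and transport cost. -/

theorem integrable_of_continuous_of_isCompact {E F : Type*} [TopologicalSpace E]
    [MeasurableSpace E] [T2Space E] [OpensMeasurableSpace E]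
    [SecondCountableTopology E] [NormedAddCommGroup F]
    {μ : Measure E} [IsFiniteMeasure μ] {K : Set E} (hK : IsCompact K) (hμ : μ Kᶜ = 0)
    {f : E → F} (hf : Continuous f) : Integrable f μ := by
  have h : IntegrableOn f K μ := hf.continuousOn.integrableOn_compact' hK hK.measurableSet
  rwa [IntegrableOn, Measure.restrict_eq_self_of_ae_mem (measure_eq_zero_iff_ae_notMem.1 hμ |>.mono
    fun x hx => Set.notMem_compl_iff.1 hx)] at h

theorem continuous_wordEval {n : ℕ} (w : List (Fin n)) :
    Continuous fun x : EuclideanSpace ℝ (Fin n) => (w.map (fun j => x j)).prod :=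
  continuous_list_prod w fun j _ => by fun_prop

/-- A compactly supported measure is determined by its moments. -/
theorem IsJointDistribution.unique {M : Type*} [CStarAlgebra M] {τ : TraceState M} {n : ℕ}
    {X : Fin n → M} {μ ν : Measure (EuclideanSpace ℝ (Fin n))}
    (hμ : IsJointDistribution τ X μ) (hν : IsJointDistribution τ X ν) : μ = ν := by
  have := hμ.isProbabilityMeasure
  have := hν.isProbabilityMeasure
  obtain ⟨K, hK, hμK⟩ := hμ.compactSupport
  obtain ⟨L, hL, hνL⟩ := hν.compactSupport
  have hKL := hK.union hL
  have hμ0 : μ (K ∪ L)ᶜ = 0 :=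
    measure_mono_null (Set.compl_subset_compl.2 Set.subset_union_left) hμK
  have hν0 : ν (K ∪ L)ᶜ = 0 :=
    measure_mono_null (Set.compl_subset_compl.2 Set.subset_union_right) hνL
  -- The polynomial functions: as an algebra they are spanned by the words in the coordinates, on
  -- which the two integrals agree by hypothesis.
  let A : Subalgebra ℝ C(EuclideanSpace ℝ (Fin n), ℝ) :=
    Algebra.adjoin ℝ (Set.range fun j => ⟨fun x => x j, by fun_prop⟩)
  have hA : ∀ g ∈ A, ∫ x, g x ∂μ = ∫ x, g x ∂ν := by
    intro g hg
    rw [← Subalgebra.mem_toSubmodule, Algebra.adjoin_eq_span] at hg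
    induction hg using Submodule.span_induction with
    | mem g h =>
      obtain ⟨l, hl, rfl⟩ := Submonoid.exists_list_of_mem_closure h
      have : ∃ w : List (Fin n), ∀ x, l.prod x = (w.map (fun j => x j)).prod := by
        clear h
        induction l with
        | nil => exact ⟨[], fun x => by simp⟩
        | cons a l ih =>
          obtain ⟨w, hw⟩ := ih fun y hy => hl y (List.mem_cons_of_mem _ hy)
          obtain ⟨j, hj⟩ := hl a List.mem_cons_self
          exact ⟨j :: w, fun x => by simp [← hj, hw]⟩
      obtain ⟨w, hw⟩ := this
      simp_rw [hw]
      exact_mod_cast (hμ.moments w).symm.trans (hν.moments w)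
    | zero => simp
    | add f g _ _ ihf ihg =>
      simp only [ContinuousMap.add_apply]
      rw [integral_add, integral_add, ihf, ihg] <;>
      first
      | exact integrable_of_continuous_of_isCompact hKL hμ0 (ContinuousMap.continuous _)
      | exact integrable_of_continuous_of_isCompact hKL hν0 (ContinuousMap.continuous _)
    | smul c f _ ihf =>
      simp only [ContinuousMap.smul_apply]
      rw [integral_smul, integral_smul, ihf]
  have hsep : A.SeparatesPoints := by
    intro x y hxy
    obtain ⟨j, hj⟩ : ∃ j, x j ≠ y j := by
      by_contra! h
      exact hxy (PiLp.ext h)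
    exact ⟨_, ⟨_, Algebra.subset_adjoin ⟨j, rfl⟩, rfl⟩, hj⟩
  refine ext_of_forall_integral_eq_of_IsFiniteMeasure fun f => ?_
  rw [← sub_eq_zero, ← abs_nonpos_iff]
  refine le_of_forall_pos_le_add fun ε hε => ?_
  -- Stone–Weierstrass on a compact set carrying both measures. The growth of `g` outside that set
  -- is harmless.
  obtain ⟨g, hgA, hg⟩ :=
    ContinuousMap.exists_mem_subalgebra_near_continuous_of_isCompact_of_separatesPoints
      hsep f.toContinuousMap hKL (half_pos hε)
  have key : ∀ (ρ : Measure (EuclideanSpace ℝ (Fin n))) [IsProbabilityMeasure ρ],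
      ρ (K ∪ L)ᶜ = 0 → |∫ x, f x ∂ρ - ∫ x, g x ∂ρ| ≤ ε / 2 := by
    intro ρ _ hρ
    have hae : ∀ᵐ x ∂ρ, x ∈ K ∪ L :=
      (measure_eq_zero_iff_ae_notMem.1 hρ).mono fun x hx => Set.notMem_compl_iff.1 hx
    rw [← integral_sub (integrable_of_continuous_of_isCompact hKL hρ f.continuous)
      (integrable_of_continuous_of_isCompact hKL hρ g.continuous)]
    have := norm_integral_le_of_norm_le_const (μ := ρ) (f := fun x => f x - g x) (C := ε / 2)
      (hae.mono fun x hx => by rw [norm_sub_rev]; exact (hg x hx).le)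
    simpa using this
  have h1 := abs_le.1 (key μ hμ0)
  have h2 := abs_le.1 (key ν hν0)
  have h3 := hA g hgA
  rw [zero_add, abs_le]
  constructor <;> linarith

/-- The quadratic transport cost of a compactly supported plan, coordinatewise. -/
theorem lintegral_cost_eq {n : ℕ}
    {π : Measure (EuclideanSpace ℝ (Fin n) × EuclideanSpace ℝ (Fin n))} [IsFiniteMeasure π]
    {K : Set (EuclideanSpace ℝ (Fin n) × EuclideanSpace ℝ (Fin n))} (hK : IsCompact K)
    (hπ : π Kᶜ = 0) :
    (∫⁻ z, ‖z.1 - z.2‖ₑ ^ 2 ∂π) ^ (1 / 2 : ℝ) =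
      ENNReal.ofReal (Real.sqrt (∑ j, ∫ z, (z.1 j - z.2 j) ^ 2 ∂π)) := by
  have hi : ∀ j : Fin n, Integrable (fun z : EuclideanSpace ℝ (Fin n) × EuclideanSpace ℝ (Fin n) =>
      (z.1 j - z.2 j) ^ 2) π := fun j =>
    integrable_of_continuous_of_isCompact hK hπ (by fun_prop)
  rw [← integral_finsetSum _ fun j _ => hi j, Real.sqrt_eq_rpow,
    ← ENNReal.ofReal_rpow_of_nonneg (integral_nonneg fun z => Finset.sum_nonneg fun j _ =>
      sq_nonneg _) (by norm_num),
    ofReal_integral_eq_lintegral_ofReal (integrable_finsetSum _ fun j _ => hi j)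
      (Filter.Eventually.of_forall fun z => Finset.sum_nonneg fun j _ => sq_nonneg _)]
  congr 2
  ext z
  rw [← ofReal_norm, ← ENNReal.ofReal_pow (norm_nonneg _), EuclideanSpace.norm_sq_eq]
  simp

/-- For self-adjoint tuples, `*`-moments are moments. -/
theorem starMoment_eq_of_isSelfAdjoint {M : Type*} [CStarAlgebra M] (τ : TraceState M) {n : ℕ}
    {X : Fin n → M} (hX : ∀ j, IsSelfAdjoint (X j)) (w : List (Fin n ⊕ Fin n)) :
    starMoment τ X w = τ ((w.map (Sum.elim id id)).map X).prod := by
  rw [starMoment, List.map_map]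
  congr 3
  ext (j | j)
  · rfl
  · simpa using (hX j).star_eq

/-! ### Classical couplings as commutative tracial `C*`-probability spaces. -/

section ClassicalModel

variable {E : Type*} [TopologicalSpace E] [MeasurableSpace E] [T2Space E]
  [BorelSpace E] [SecondCountableTopology E]

/-- Integration against a probability measure on a compact set, as a trace state on the continuous
functions on a copy of that set in a prescribed universe. -/
noncomputable def integralTraceState (K : Set E) [CompactSpace K] (π : Measure E)
    [IsProbabilityMeasure π] (hπ : π Kᶜ = 0) : TraceState C(ULift.{w} K, ℂ) :=
  have hK : IsCompact K := isCompact_iff_compactSpace.2 ‹_›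
  have hi : ∀ f : C(ULift.{w} K, ℂ),
      Integrable (fun x : K => f ⟨x⟩) (π.comap Subtype.val) := fun f =>
    integrable_of_continuous_of_isCompact isCompact_univ (by simp)
      (f.continuous.comp continuous_uliftUp)
  { toLinearMap :=
    { toFun := fun f => ∫ x : K, f ⟨x⟩ ∂(π.comap Subtype.val)
      map_add' := fun f g => integral_add (hi f) (hi g)
      map_smul' := fun c f => by simp [integral_const_mul] }
    map_one' := by
      have h := integral_subtype_comap (μ := π) hK.measurableSet fun _ => (1 : ℂ)
      rw [Measure.restrict_eq_self_of_ae_mem ((measure_eq_zero_iff_ae_notMem.1 hπ).mono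
        fun x hx => Set.notMem_compl_iff.1 hx)] at h
      simpa using h
    nonneg' := fun f => by
      refine integral_nonneg fun x => ?_
      exact star_mul_self_nonneg (f ⟨x⟩)
    tracial' := fun f g => by rw [mul_comm] }

theorem integralTraceState_apply (K : Set E) [CompactSpace K] (π : Measure E)
    [IsProbabilityMeasure π] (hπ : π Kᶜ = 0) (f : C(ULift.{w} K, ℂ)) (g : E → ℂ)
    (hfg : ∀ x : K, f ⟨x⟩ = g x) :
    integralTraceState K π hπ f = ∫ x, g x ∂π := by
  have hK : IsCompact K := isCompact_iff_compactSpace.2 ‹_›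
  change ∫ x : K, f ⟨x⟩ ∂(π.comap Subtype.val) = _
  simp_rw [hfg]
  rw [integral_subtype_comap hK.measurableSet,
    Measure.restrict_eq_self_of_ae_mem ((measure_eq_zero_iff_ae_notMem.1 hπ).mono
        fun x hx => Set.notMem_compl_iff.1 hx)]

/-- A real continuous function as an element of the model algebra. -/
noncomputable def modelFunction (K : Set E) (f : E → ℝ) (hf : Continuous f) :
    C(ULift.{w} K, ℂ) :=
  ⟨fun x => (f x.down : ℂ), by fun_prop⟩

theorem isSelfAdjoint_modelFunction {S : Type*} [TopologicalSpace S] (K : Set S) (f : S → ℝ) (hf : Continuous f) :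
    IsSelfAdjoint (modelFunction K f hf) := by
  ext x
  exact Complex.conj_ofReal _

/-- Real functions are self-adjoint, so only plain words matter, and a change of variables along `p`
turns these into moments of `π.map p`. It is meant for `p` either projection of a coupling. -/
theorem sameStarDistribution_modelFunction {M : Type*} [CStarAlgebra M] {τ : TraceState M} {n : ℕ}
    {X : Fin n → M} (hX : ∀ j, IsSelfAdjoint (X j))
    (K : Set E) [CompactSpace K] (π : Measure E) [IsProbabilityMeasure π] (hπ : π Kᶜ = 0)
    (p : E → EuclideanSpace ℝ (Fin n)) (hp : Continuous p)
    (h : IsJointDistribution τ X (π.map p)) :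
    SameStarDistribution (integralTraceState K π hπ) τ
      (fun j => modelFunction K (fun x => p x j) (by fun_prop)) X := by
  intro w
  rw [starMoment_eq_of_isSelfAdjoint _ fun j => isSelfAdjoint_modelFunction _ _ _,
    starMoment_eq_of_isSelfAdjoint _ hX, h.moments,
    integral_map hp.aemeasurable (continuous_wordEval _).aestronglyMeasurable,
    integralTraceState_apply K π hπ (g := fun x =>
      (((((w.map (Sum.elim id id)).map fun j => p x j).prod : ℝ)) : ℂ)), integral_complex_ofReal]
  intro x
  induction w.map (Sum.elim id id) with
  | nil => simp
  | cons a w ih =>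
    rw [List.map_cons, List.prod_cons, ContinuousMap.mul_apply, ih]
    simp [modelFunction]

end ClassicalModel

/-- The product of compact sets carrying the marginals carries the coupling. -/
theorem exists_isCompact_coupling_compl_eq_zero {E F : Type*} [TopologicalSpace E] [T2Space E]
    [MeasurableSpace E] [BorelSpace E] [TopologicalSpace F] [T2Space F]
    [MeasurableSpace F] [BorelSpace F] {π : Measure (E × F)} {K : Set E} {L : Set F}
    (hK : IsCompact K) (hL : IsCompact L) (hπK : π.fst Kᶜ = 0) (hπL : π.snd Lᶜ = 0) :
    ∃ S : Set (E × F), IsCompact S ∧ π Sᶜ = 0 := by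
  refine ⟨K ×ˢ L, hK.prod hL, ?_⟩
  rw [Measure.fst_apply hK.measurableSet.compl] at hπK
  rw [Measure.snd_apply hL.measurableSet.compl] at hπL
  refine measure_mono_null (fun z hz => ?_) (measure_union_null hπK hπL)
  simp only [Set.mem_compl_iff, Set.mem_prod, not_and_or] at hz
  exact hz

theorem freeWasserstein_le {M₁ : Type u} {M₂ : Type v} {M₃ : Type w}
    [CStarAlgebra M₁] [CStarAlgebra M₂] [inst₃ : CStarAlgebra M₃] {τ₁ : TraceState M₁}
    {τ₂ : TraceState M₂} (τ₃ : TraceState M₃) {n : ℕ} {X : Fin n → M₁} {Y : Fin n → M₂}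
    {X' Y' : Fin n → M₃} (hX : SameStarDistribution τ₃ τ₁ X' X)
    (hY : SameStarDistribution τ₃ τ₂ Y' Y) :
    freeWasserstein.{u, v, w} τ₁ τ₂ X Y ≤
      ENNReal.ofReal (Real.sqrt (∑ j, norm2 τ₃ (X' j - Y' j) ^ 2)) := by
  unfold freeWasserstein
  refine (iInf_le _ M₃).trans ((iInf_le _ inst₃).trans ((iInf_le _ τ₃).trans
    ((iInf_le _ X').trans ((iInf_le _ Y').trans ((iInf_le _ hX).trans (iInf_le _ hY))))))

theorem freeWasserstein_le_classicalWasserstein {M₁ : Type u} {M₂ : Type v}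
    [CStarAlgebra M₁] [CStarAlgebra M₂] {τ₁ : TraceState M₁} {τ₂ : TraceState M₂} {n : ℕ}
    {X : Fin n → M₁} {Y : Fin n → M₂} (hX : ∀ j, IsSelfAdjoint (X j))
    (hY : ∀ j, IsSelfAdjoint (Y j)) {μ ν : Measure (EuclideanSpace ℝ (Fin n))}
    (hμ : IsJointDistribution τ₁ X μ) (hν : IsJointDistribution τ₂ Y ν) :
    freeWasserstein.{u, v, w} τ₁ τ₂ X Y ≤ classicalWasserstein μ ν := by
  refine le_iInf fun π => le_iInf fun hπ => le_iInf fun hπ₁ => le_iInf fun hπ₂ => ?_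
  subst hπ₁ hπ₂
  obtain ⟨K₁, hK₁, hπ₁⟩ := hμ.compactSupport
  obtain ⟨K₂, hK₂, hπ₂⟩ := hν.compactSupport
  obtain ⟨K, hK, hπK⟩ := exists_isCompact_coupling_compl_eq_zero hK₁ hK₂ hπ₁ hπ₂
  have : CompactSpace K := isCompact_iff_compactSpace.1 hK
  rw [lintegral_cost_eq hK hπK]
  refine (freeWasserstein_le (integralTraceState K π hπK)
    (sameStarDistribution_modelFunction hX K π hπK Prod.fst continuous_fst hμ)
    (sameStarDistribution_modelFunction hY K π hπK Prod.snd continuous_snd hν)).trans_eq ?_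
  congr 3
  ext j
  rw [norm2, Real.sq_sqrt (Complex.le_def.1 (TraceState.nonneg' _ _)).1,
    integralTraceState_apply K π hπK (g := fun z => (((z.1 j - z.2 j) ^ 2 : ℝ) : ℂ)),
    integral_complex_ofReal, Complex.ofReal_re]
  intro z
  simp [modelFunction, sq]

/-! ### Left and right multiplication on the GNS space of a trace. -/

section GNS

open scoped InnerProductSpace
open UniformSpace.Completion

variable {M : Type*} [CStarAlgebra M] [PartialOrder M] [StarOrderedRing M]

/-- A trace state as a positive linear map. -/
noncomputable def TraceState.toPositiveLinearMap (τ : TraceState M) : M →ₚ[ℂ] ℂ :=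
  PositiveLinearMap.mk₀ τ.toLinearMap fun x hx => by
    obtain ⟨a, rfl⟩ := CStarAlgebra.nonneg_iff_eq_star_mul_self.1 hx
    exact τ.nonneg' a

theorem TraceState.toPositiveLinearMap_apply (τ : TraceState M) (a : M) :
    τ.toPositiveLinearMap a = τ a := rfl

variable (τ : TraceState M)

theorem TraceState.norm_toPreGNS_star (a : M) :
    ‖τ.toPositiveLinearMap.toPreGNS (star a)‖ = ‖τ.toPositiveLinearMap.toPreGNS a‖ := by
  simp only [PositiveLinearMap.preGNS_norm_def, PositiveLinearMap.ofPreGNS_toPreGNS,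
    TraceState.toPositiveLinearMap_apply]
  rw [τ.tracial', star_star]

theorem TraceState.norm_toPreGNS_mul_le (a b : M) :
    ‖τ.toPositiveLinearMap.toPreGNS (a * b)‖ ≤ ‖a‖ * ‖τ.toPositiveLinearMap.toPreGNS b‖ :=
  (τ.toPositiveLinearMap.leftMulMapPreGNS a).le_of_opNorm_le
    (LinearMap.mkContinuous_norm_le _ (norm_nonneg a) _) (τ.toPositiveLinearMap.toPreGNS b)

/-- By traciality the star is isometric for the 2-norm, and it exchanges right and left
multiplication. -/
theorem TraceState.norm_toPreGNS_mul_le' (a b : M) :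
    ‖τ.toPositiveLinearMap.toPreGNS (a * b)‖ ≤ ‖b‖ * ‖τ.toPositiveLinearMap.toPreGNS a‖ := by
  rw [← τ.norm_toPreGNS_star, star_mul, ← τ.norm_toPreGNS_star a, ← norm_star b]
  exact τ.norm_toPreGNS_mul_le _ _

/-- Right multiplication on the pre-GNS space of a trace state. -/
noncomputable def TraceState.rightMulPreGNS (b : M) :
    τ.toPositiveLinearMap.PreGNS →L[ℂ] τ.toPositiveLinearMap.PreGNS :=
  (τ.toPositiveLinearMap.toPreGNS.toLinearMap ∘ₗ LinearMap.mulRight ℂ b ∘ₗ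
    τ.toPositiveLinearMap.ofPreGNS.toLinearMap).mkContinuous ‖b‖ fun x =>
      τ.norm_toPreGNS_mul_le' (τ.toPositiveLinearMap.ofPreGNS x) b

@[simp]
theorem TraceState.rightMulPreGNS_apply (b : M) (x : τ.toPositiveLinearMap.PreGNS) :
    τ.rightMulPreGNS b x =
      τ.toPositiveLinearMap.toPreGNS (τ.toPositiveLinearMap.ofPreGNS x * b) := rfl

/-- The representation of the opposite algebra by right multiplication on the GNS space of a
trace state. -/
noncomputable def TraceState.gnsRight :
    Mᵐᵒᵖ →⋆ₐ[ℂ] (τ.toPositiveLinearMap.GNS →L[ℂ] τ.toPositiveLinearMap.GNS) where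
  toFun b := (τ.rightMulPreGNS b.unop).completion
  map_one' := by
    ext c
    induction c using induction_on with
    | hp => apply isClosed_eq <;> fun_prop
    | ih c => simp
  map_mul' _ _ := by
    ext c
    induction c using induction_on with
    | hp => apply isClosed_eq <;> fun_prop
    | ih c => simp [mul_assoc]
  map_zero' := by
    ext c
    induction c using induction_on with
    | hp => apply isClosed_eq <;> fun_prop
    | ih c => simp [UniformSpace.Completion.coe_zero]
  map_add' _ _ := by
    ext c
    induction c using induction_on with
    | hp => apply isClosed_eq <;> fun_prop
    | ih c => simp [mul_add, UniformSpace.Completion.coe_add]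
  commutes' r := by
    ext c
    induction c using induction_on with
    | hp => apply isClosed_eq <;> fun_prop
    | ih c => simp [Algebra.algebraMap_eq_smul_one]
  map_star' b := by
    refine (ContinuousLinearMap.eq_adjoint_iff _ _).mpr ?_
    intro x y
    induction x, y using induction_on₂ with
    | hp => apply isClosed_eq <;> fun_prop
    | ih x y =>
      simp only [MulOpposite.unop_star, ContinuousLinearMap.completion_apply_coe,
        UniformSpace.Completion.inner_coe, PositiveLinearMap.preGNS_inner_def,
        rightMulPreGNS_apply, PositiveLinearMap.ofPreGNS_toPreGNS, star_mul, star_star,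
        TraceState.toPositiveLinearMap_apply]
      -- `τ(b x* y) = τ(x* y b)`: the adjoint relation for right multiplication is traciality.
      rw [mul_assoc, τ.tracial', mul_assoc]

theorem TraceState.gnsRight_apply_coe (b : Mᵐᵒᵖ) (x : τ.toPositiveLinearMap.PreGNS) :
    τ.gnsRight b x = τ.rightMulPreGNS b.unop x :=
  ContinuousLinearMap.completion_apply_coe _ _

theorem TraceState.gnsLeft_apply_coe (a : M) (x : τ.toPositiveLinearMap.PreGNS) :
    τ.toPositiveLinearMap.gnsStarAlgHom a x = τ.toPositiveLinearMap.leftMulMapPreGNS a x :=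
  PositiveLinearMap.gnsNonUnitalStarAlgHom_apply_coe _

theorem TraceState.commute_gnsLeft_gnsRight (a : M) (b : Mᵐᵒᵖ) :
    Commute (τ.toPositiveLinearMap.gnsStarAlgHom a) (τ.gnsRight b) := by
  ext c
  induction c using induction_on with
  | hp => apply isClosed_eq <;> fun_prop
  | ih c =>
    simp only [mul_apply_eq_comp, gnsRight_apply_coe, gnsLeft_apply_coe]
    simp [mul_assoc]

theorem TraceState.norm_toPreGNS_eq_zero {c : M} (hc : τ (star c * c) = 0) :
    ‖τ.toPositiveLinearMap.toPreGNS c‖ = 0 := by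
  rw [PositiveLinearMap.preGNS_norm_def]
  simp [TraceState.toPositiveLinearMap_apply, hc]

/-- On the dense subspace, `|c x|_2 ≤ ‖x‖ |c|_2 = 0`. This is the bound that needs the trace; for a
general state only the image of the vacuum would have to vanish. -/
theorem TraceState.gnsLeft_eq_zero {c : M} (hc : τ (star c * c) = 0) :
    τ.toPositiveLinearMap.gnsStarAlgHom c = 0 := by
  ext x
  induction x using induction_on with
  | hp => apply isClosed_eq <;> fun_prop
  | ih x =>
    rw [gnsLeft_apply_coe, zero_apply, ← norm_eq_zero, UniformSpace.Completion.norm_coe]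
    refine le_antisymm ((τ.norm_toPreGNS_mul_le' c _).trans ?_) (norm_nonneg _)
    rw [τ.norm_toPreGNS_eq_zero hc, mul_zero]

theorem TraceState.gnsRight_eq_zero {c : M} (hc : τ (star c * c) = 0) :
    τ.gnsRight (MulOpposite.op c) = 0 := by
  ext x
  induction x using induction_on with
  | hp => apply isClosed_eq <;> fun_prop
  | ih x =>
    rw [gnsRight_apply_coe, zero_apply, ← norm_eq_zero, UniformSpace.Completion.norm_coe]
    refine le_antisymm ((τ.norm_toPreGNS_mul_le _ c).trans ?_) (norm_nonneg _)
    rw [τ.norm_toPreGNS_eq_zero hc, mul_zero]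

/-- The vacuum vector of the GNS space. -/
noncomputable def TraceState.vacuum : τ.toPositiveLinearMap.GNS :=
  (τ.toPositiveLinearMap.toPreGNS 1 : τ.toPositiveLinearMap.PreGNS)

theorem TraceState.inner_vacuum_gnsLeft_gnsRight (a b : M) :
    ⟪τ.vacuum, (τ.toPositiveLinearMap.gnsStarAlgHom a * τ.gnsRight (MulOpposite.op b)) τ.vacuum⟫_ℂ
      = τ (a * b) := by
  simp only [vacuum, mul_apply_eq_comp, gnsRight_apply_coe, gnsLeft_apply_coe,
    UniformSpace.Completion.inner_coe, PositiveLinearMap.preGNS_inner_def]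
  simp [TraceState.toPositiveLinearMap_apply]

end GNS

/-! ### Joint spectral measures in a vector state. -/

/-- Commuting self-adjoint operators have a joint spectral distribution in a vector state. -/
theorem exists_jointDistribution_vectorState {H : Type*} [NormedAddCommGroup H]
    [InnerProductSpace ℂ H] [CompleteSpace H] {Ω : H} (hΩ : ‖Ω‖ = 1) {n : ℕ}
    (Z : Fin n → H →L[ℂ] H) (hZ : ∀ j, IsSelfAdjoint (Z j)) (hZc : ∀ i j, Commute (Z i) (Z j)) :
    ∃ μ : Measure (EuclideanSpace ℝ (Fin n)), IsProbabilityMeasure μ ∧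
      (∃ K, IsCompact K ∧ μ Kᶜ = 0) ∧
      ∀ w : List (Fin n), inner ℂ Ω ((w.map Z).prod Ω) =
        ((∫ x, (w.map (fun j => x j)).prod ∂μ : ℝ) : ℂ) := by
  let S₀ := StarAlgebra.adjoin ℂ (Set.range Z)
  have hS₀ : ∀ a b : S₀, a * b = b * a := by
    have := StarAlgebra.isMulCommutative_adjoin ℂ (s := Set.range Z)
      (by rintro _ ⟨i, rfl⟩ _ ⟨j, rfl⟩; exact hZc i j)
      (by rintro _ ⟨i, rfl⟩ _ ⟨j, rfl⟩; rw [(hZ j).star_eq]; exact hZc i j)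
    exact fun a b => this.is_comm.comm a b
  let S := S₀.topologicalClosure
  have hS : ∀ a b : S, a * b = b * a := by
    let _ := StarSubalgebra.commRingTopologicalClosure S₀ hS₀
    exact fun a b => mul_comm a b
  have : IsClosed (S : Set (H →L[ℂ] H)) := StarSubalgebra.isClosed_topologicalClosure S₀
  let _ : CStarAlgebra (H →L[ℂ] H) := {}
  let _ : CommCStarAlgebra S := { (inferInstance : CStarAlgebra S) with mul_comm := hS }
  let τS : TraceState S :=
    { toLinearMap :=
      { toFun := fun a => inner ℂ Ω ((a : H →L[ℂ] H) Ω)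
        map_add' := fun a b => by simp
        map_smul' := fun c a => by simp }
      map_one' := by simp [inner_self_eq_norm_sq_to_K, hΩ]
      nonneg' := fun a => by
        change 0 ≤ inner ℂ Ω ((star (a : H →L[ℂ] H) * (a : H →L[ℂ] H)) Ω)
        rw [ContinuousLinearMap.star_eq_adjoint, mul_apply_eq_comp,
          ContinuousLinearMap.adjoint_inner_right, inner_self_eq_norm_sq_to_K]
        have h := sq_nonneg ‖(a : H →L[ℂ] H) Ω‖
        rw [← RCLike.ofReal_pow]
        exact Complex.zero_le_real.2 h
      -- A vector state on `B(H)` is not tracial in general, but on a commutative subalgebra it is.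
      tracial' := fun a b => by rw [hS] }
  let ZS : Fin n → S := fun j =>
    ⟨Z j, StarSubalgebra.le_topologicalClosure _ (StarAlgebra.subset_adjoin ℂ _ ⟨j, rfl⟩)⟩
  obtain ⟨μ, h1, h2, h3⟩ := exists_isJointDistribution_of_comm τS ZS
    (fun j => Subtype.ext (hZ j))
  refine ⟨μ, h1, h2, fun w => ?_⟩
  rw [← h3 w]
  change _ = inner ℂ Ω ((((w.map ZS).prod : S) : H →L[ℂ] H) Ω)
  congr 2
  induction w with
  | nil => rfl
  | cons a w ih => simp only [List.map_cons, List.prod_cons, ih]; rfl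

/-! ### Relations modulo the null ideal of the trace. -/

/-- The square expands into four `*`-moments of length two, all equal to `σ (b j * b j)`, with signs
that cancel. -/
theorem SameStarDistribution.star_sub_self_null {M N : Type*} [CStarAlgebra M] [CStarAlgebra N]
    {τ : TraceState M} {σ : TraceState N} {n : ℕ} {a : Fin n → M} {b : Fin n → N}
    (h : SameStarDistribution τ σ a b) (hb : ∀ j, IsSelfAdjoint (b j)) (j : Fin n) :
    τ (star (a j - star (a j)) * (a j - star (a j))) = 0 := by
  have h1 := h [.inr j, .inl j]
  have h2 := h [.inr j, .inr j]
  have h3 := h [.inl j, .inl j]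
  have h4 := h [.inl j, .inr j]
  simp only [starMoment, List.map_cons, List.map_nil, List.prod_cons, List.prod_nil, mul_one,
    Sum.elim_inl, Sum.elim_inr, (hb j).star_eq] at h1 h2 h3 h4
  simp only [star_sub, star_star, sub_mul, mul_sub, map_sub, h1, h2, h3, h4]
  ring

/-- Again four `*`-moments: computed with `b`, they cancel in pairs once the last two letters are
commuted. -/
theorem SameStarDistribution.commutator_null {M N : Type*} [CStarAlgebra M] [CStarAlgebra N]
    {τ : TraceState M} {σ : TraceState N} {n : ℕ} {a : Fin n → M} {b : Fin n → N}
    (h : SameStarDistribution τ σ a b) (hb : ∀ j, IsSelfAdjoint (b j))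
    (hbc : ∀ i j, Commute (b i) (b j)) (i j : Fin n) :
    τ (star (a i * a j - a j * a i) * (a i * a j - a j * a i)) = 0 := by
  have h1 := h [.inr j, .inr i, .inl i, .inl j]
  have h2 := h [.inr j, .inr i, .inl j, .inl i]
  have h3 := h [.inr i, .inr j, .inl i, .inl j]
  have h4 := h [.inr i, .inr j, .inl j, .inl i]
  simp only [starMoment, List.map_cons, List.map_nil, List.prod_cons, List.prod_nil, mul_one,
    Sum.elim_inl, Sum.elim_inr, (hb i).star_eq, (hb j).star_eq, (hbc j i).eq] at h1 h2 h3 h4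
  simp only [star_sub, star_mul, sub_mul, mul_sub, map_sub, mul_assoc, h1, h2, h3, h4]
  ring

theorem SameStarDistribution.moment_eq {M N : Type*} [CStarAlgebra M] [CStarAlgebra N]
    {τ : TraceState M} {σ : TraceState N} {n : ℕ} {a : Fin n → M} {b : Fin n → N}
    (h : SameStarDistribution τ σ a b) (w : List (Fin n)) :
    τ (w.map a).prod = σ (w.map b).prod := by
  simpa [starMoment, Function.comp_def] using h (w.map .inl)

theorem TraceState.map_mul_eq_zero_of_null {M : Type*} [CStarAlgebra M] (τ : TraceState M) {c : M}
    (hc : τ (star c * c) = 0) (a : M) : τ (c * a) = 0 := by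
  let _ := CStarAlgebra.spectralOrder M
  let _ := CStarAlgebra.spectralOrderedRing M
  rw [← τ.inner_vacuum_gnsLeft_gnsRight, τ.gnsLeft_eq_zero hc, zero_mul, zero_apply,
    inner_zero_right]

/-- Modulo the null ideal the stars disappear, and the trace merges the two cross terms. The result
involves only moments with `x` to the left of `y`, the ones the bimodule law reproduces. -/
theorem norm2_sub_sq_eq {M : Type*} [CStarAlgebra M] (τ : TraceState M) {x y : M}
    (hx : τ (star (x - star x) * (x - star x)) = 0)
    (hy : τ (star (y - star y) * (y - star y)) = 0) :
    norm2 τ (x - y) ^ 2 = (τ (x * x)).re - 2 * (τ (x * y)).re + (τ (y * y)).re := by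
  have hx' : ∀ a, τ (star x * a) = τ (x * a) := fun a => by
    have := τ.map_mul_eq_zero_of_null hx a
    rw [sub_mul, map_sub, sub_eq_zero] at this
    exact this.symm
  have hy' : ∀ a, τ (star y * a) = τ (y * a) := fun a => by
    have := τ.map_mul_eq_zero_of_null hy a
    rw [sub_mul, map_sub, sub_eq_zero] at this
    exact this.symm
  rw [norm2, Real.sq_sqrt (Complex.le_def.1 (TraceState.nonneg' _ _)).1, star_sub, sub_mul,
    mul_sub, mul_sub, map_sub, map_sub, map_sub, hx', hx', hy', hy', τ.tracial' y x]
  simp only [Complex.sub_re]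
  ring

/-- Two tuples that are self-adjoint and commuting modulo the null ideal of the trace have a
joint law on the product space: the law of left multiplication by the first and right
multiplication by the second in the vacuum state. -/
theorem exists_bimodule_law {M : Type*} [CStarAlgebra M] (τ : TraceState M) {n : ℕ}
    (x y : Fin n → M)
    (hx : ∀ j, τ (star (x j - star (x j)) * (x j - star (x j))) = 0)
    (hy : ∀ j, τ (star (y j - star (y j)) * (y j - star (y j))) = 0)
    (hxc : ∀ i j, τ (star (x i * x j - x j * x i) * (x i * x j - x j * x i)) = 0)
    (hyc : ∀ i j, τ (star (y i * y j - y j * y i) * (y i * y j - y j * y i)) = 0) :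
    ∃ π : Measure (EuclideanSpace ℝ (Fin n) × EuclideanSpace ℝ (Fin n)), IsProbabilityMeasure π ∧
      (∃ K, IsCompact K ∧ π Kᶜ = 0) ∧
      ∀ v w : List (Fin n), τ ((v.map x).prod * (w.map y).prod) =
        ((∫ z, (v.map (fun j => z.1 j)).prod * (w.map (fun j => z.2 j)).prod ∂π : ℝ) : ℂ) := by
  let _ := CStarAlgebra.spectralOrder M
  let _ := CStarAlgebra.spectralOrderedRing M
  let L := τ.toPositiveLinearMap.gnsStarAlgHom
  let R := τ.gnsRight
  have hΩ : ‖τ.vacuum‖ = 1 := by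
    have h := τ.inner_vacuum_gnsLeft_gnsRight 1 1
    rw [map_one, MulOpposite.op_one, map_one, mul_one, mul_one, τ.map_one',
      one_apply_eq_self, inner_self_eq_norm_sq_to_K, ← RCLike.ofReal_pow] at h
    have h' : ‖τ.vacuum‖ ^ 2 = 1 := Complex.ofReal_eq_one.1 h
    exact (pow_eq_one_iff_of_nonneg (norm_nonneg _) two_ne_zero).1 h'
  let Z : Fin (n + n) → (τ.toPositiveLinearMap.GNS →L[ℂ] τ.toPositiveLinearMap.GNS) :=
    Fin.append (fun j => L (x j)) (fun j => R (.op (y j)))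
  have hZ : ∀ j, IsSelfAdjoint (Z j) := by
    intro j
    refine Fin.addCases (fun j => ?_) (fun j => ?_) j
    · simp only [Z, Fin.append_left]
      have := τ.gnsLeft_eq_zero (hx j)
      rw [map_sub, map_star, sub_eq_zero] at this
      exact this.symm
    · simp only [Z, Fin.append_right]
      have := τ.gnsRight_eq_zero (hy j)
      rw [MulOpposite.op_sub, MulOpposite.op_star, map_sub, map_star, sub_eq_zero] at this
      exact this.symm
  have hLR : ∀ i j, Commute (L (x i)) (R (.op (y j))) :=
    fun i j => τ.commute_gnsLeft_gnsRight _ _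
  have hZc : ∀ i j, Commute (Z i) (Z j) := by
    intro i j
    refine Fin.addCases (fun i => ?_) (fun i => ?_) i <;>
      refine Fin.addCases (fun j => ?_) (fun j => ?_) j <;>
      simp only [Z, Fin.append_left, Fin.append_right]
    · have := τ.gnsLeft_eq_zero (hxc i j)
      rw [map_sub, map_mul, map_mul, sub_eq_zero] at this
      exact this
    · exact hLR i j
    · exact (hLR j i).symm
    -- The indices are exchanged because `op` reverses products.
    · have := τ.gnsRight_eq_zero (hyc j i)
      rw [MulOpposite.op_sub, MulOpposite.op_mul, MulOpposite.op_mul, map_sub, map_mul, map_mul,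
        sub_eq_zero] at this
      exact this
  obtain ⟨μ, hμ, ⟨K, hK, hμK⟩, hmom⟩ := exists_jointDistribution_vectorState hΩ Z hZ hZc
  let p : EuclideanSpace ℝ (Fin (n + n)) → EuclideanSpace ℝ (Fin n) × EuclideanSpace ℝ (Fin n) :=
    fun z => (WithLp.toLp 2 fun j => z (Fin.castAdd n j), WithLp.toLp 2 fun j => z (Fin.natAdd n j))
  have hp : Continuous p := by
    refine Continuous.prodMk ((PiLp.continuous_toLp 2 _).comp ?_)
      ((PiLp.continuous_toLp 2 _).comp ?_) <;> fun_prop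
  refine ⟨μ.map p, Measure.isProbabilityMeasure_map hp.aemeasurable, ⟨p '' K, hK.image hp, ?_⟩,
    fun v w => ?_⟩
  · rw [Measure.map_apply hp.measurable (hK.image hp).measurableSet.compl]
    exact measure_mono_null (fun z hz hzK => hz ⟨z, hzK, rfl⟩) hμK
  · rw [integral_map hp.aemeasurable (by
      exact (((continuous_wordEval v).comp continuous_fst).mul
        ((continuous_wordEval w).comp continuous_snd)).aestronglyMeasurable),
      ← τ.inner_vacuum_gnsLeft_gnsRight]
    -- Right multiplications compose in reverse order, so `w` is reversed to produce right
    -- multiplication by `w(y)`. On the side of the integral the letters are real numbers and the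
    -- reversal is undone at the end.
    have h := hmom (v.map (Fin.castAdd n) ++ (w.map (Fin.natAdd n)).reverse)
    have hl : (v.map fun j => L (x j)).prod = L (v.map x).prod := by
      rw [map_list_prod, List.map_map]; rfl
    have hr : ((w.reverse).map fun j => R (.op (y j))).prod = R (.op (w.map y).prod) := by
      rw [MulOpposite.op_list_prod, map_list_prod, ← List.map_reverse, ← List.map_reverse,
        List.map_map, List.map_map]
      rfl
    simp only [List.map_append, List.map_map, List.prod_append, ← List.map_reverse,
      Function.comp_def, Z, Fin.append_left, Fin.append_right, hl, hr] at h
    rw [h]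
    congr 2
    ext z
    simp only [p, List.map_reverse, List.prod_reverse]

/-! ### The lower bound and the conclusion. -/

theorem classicalWasserstein_le_freeWasserstein {M₁ : Type u} {M₂ : Type v}
    [CStarAlgebra M₁] [CStarAlgebra M₂] {τ₁ : TraceState M₁} {τ₂ : TraceState M₂} {n : ℕ}
    {X : Fin n → M₁} {Y : Fin n → M₂} (hX : ∀ j, IsSelfAdjoint (X j))
    (hXc : ∀ i j, Commute (X i) (X j)) (hY : ∀ j, IsSelfAdjoint (Y j))
    (hYc : ∀ i j, Commute (Y i) (Y j)) {μ ν : Measure (EuclideanSpace ℝ (Fin n))}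
    (hμ : IsJointDistribution τ₁ X μ) (hν : IsJointDistribution τ₂ Y ν) :
    classicalWasserstein μ ν ≤ freeWasserstein.{u, v, w} τ₁ τ₂ X Y := by
  refine le_iInf fun M => le_iInf fun _ => le_iInf fun τ => le_iInf fun x => le_iInf fun y =>
    le_iInf fun hx => le_iInf fun hy => ?_
  have hx0 := hx.star_sub_self_null hX
  have hy0 := hy.star_sub_self_null hY
  obtain ⟨π, hπ, ⟨K, hK, hπK⟩, hmom⟩ := exists_bimodule_law τ x y hx0 hy0
    (hx.commutator_null hX hXc) (hy.commutator_null hY hYc)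
  have hcompact : ∀ q : EuclideanSpace ℝ (Fin n) × EuclideanSpace ℝ (Fin n) →
      EuclideanSpace ℝ (Fin n), Continuous q → IsCompact (q '' K) ∧ (π.map q) (q '' K)ᶜ = 0 := by
    refine fun q hq => ⟨hK.image hq, ?_⟩
    rw [Measure.map_apply hq.measurable (hK.image hq).measurableSet.compl]
    exact measure_mono_null (fun z hz hzK => hz ⟨z, hzK, rfl⟩) hπK
  -- An empty second word leaves the moments of `x` alone, which are those of `X`; a compactly
  -- supported law is determined by them.
  have h1 : π.fst = μ := by
    refine IsJointDistribution.unique (τ := τ₁) (X := X)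
      ⟨inferInstance, ⟨_, hcompact _ continuous_fst⟩, fun w => ?_⟩ hμ
    rw [← hx.moment_eq, Measure.fst, integral_map continuous_fst.aemeasurable
      (continuous_wordEval w).aestronglyMeasurable]
    simpa using hmom w []
  have h2 : π.snd = ν := by
    refine IsJointDistribution.unique (τ := τ₂) (X := Y)
      ⟨inferInstance, ⟨_, hcompact _ continuous_snd⟩, fun w => ?_⟩ hν
    rw [← hy.moment_eq, Measure.snd, integral_map continuous_snd.aemeasurable
      (continuous_wordEval w).aestronglyMeasurable]
    simpa using hmom [] w
  refine (iInf_le _ π).trans ((iInf_le _ hπ).trans ((iInf_le _ h1).trans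
    ((iInf_le _ h2).trans_eq ?_)))
  rw [lintegral_cost_eq hK hπK]
  congr 3
  ext j
  rw [norm2_sub_sq_eq τ (hx0 j) (hy0 j)]
  -- The three quadratic moments that make up the cost of the `j`-th coordinate.
  have hxx := hmom [j, j] []
  have hxy := hmom [j] [j]
  have hyy := hmom [] [j, j]
  simp only [List.map_cons, List.map_nil, List.prod_cons, List.prod_nil, mul_one, one_mul]
    at hxx hxy hyy
  rw [hxx, hxy, hyy, Complex.ofReal_re, Complex.ofReal_re, Complex.ofReal_re,
    ← integral_const_mul, ← integral_sub, ← integral_add]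
  · congr 1
    ext z
    ring
  all_goals exact integrable_of_continuous_of_isCompact hK hπK (by fun_prop)

end FreeProb

theorem theorem1p5 {M₁ : Type u} {M₂ : Type v} [CStarAlgebra M₁] [CStarAlgebra M₂]
    (τ₁ : FreeProb.TraceState M₁) (τ₂ : FreeProb.TraceState M₂) (n : ℕ)
    (X : Fin n → M₁) (Y : Fin n → M₂)
    (hX : ∀ j, IsSelfAdjoint (X j)) (hXc : ∀ i j, Commute (X i) (X j))
    (hY : ∀ j, IsSelfAdjoint (Y j)) (hYc : ∀ i j, Commute (Y i) (Y j)) :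
    FreeProb.freeWasserstein.{u, v, w} τ₁ τ₂ X Y =
      FreeProb.classicalWasserstein
        (FreeProb.jointDistribution τ₁ X hX hXc)
        (FreeProb.jointDistribution τ₂ Y hY hYc) :=
  le_antisymm
    (FreeProb.freeWasserstein_le_classicalWasserstein hX hY
      (FreeProb.isJointDistribution_jointDistribution τ₁ X hX hXc)
      (FreeProb.isJointDistribution_jointDistribution τ₂ Y hY hYc))
    (FreeProb.classicalWasserstein_le_freeWasserstein hX hXc hY hYc
      (FreeProb.isJointDistribution_jointDistribution τ₁ X hX hXc)
      (FreeProb.isJointDistribution_jointDistribution τ₂ Y hY hYc))
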